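/- There is an absolute constant $c>0.1489$ such that the following holds. Let $n\ge 1$, let $(\Omega,\mathcal F)$ be any measurable space, and let $P_1,\dots,P_n,Q_1,\dots,Q_n$ be arbitrary probability measures on $(\Omega,\mathcal F)$. Put $\bar P:=\frac1n\sum_{i=1}^n P_i$ and $\bar Q:=\frac1n\sum_{i=1}^n Q_i$, and for probability measures $\mu,\nu$ on a common measurable space let $\mathrm{TV}(\mu,\nu):=\sup_{E}|\mu(E)-\nu(E)|$, the supremum being over all measurable sets $E$. Then $$\mathrm{TV}\Big(\bigotimes_{i=1}^n P_i,\ \bigotimes_{i=1}^n Q_i\Big)\ \ge\ c\,\mathrm{TV}\big(\bar P^{\otimes n},\bar Q^{\otimes n}\big).$$ Moreover, if $\Omega$ is finite and $\mathcal F$ is the $\sigma$-algebra of all its subsets, then $$\mathrm{TV}\big(\bar P^{\otimes n},\bar Q^{\otimes n}\big)=\mathrm{TV}\big(\mathrm{Mult}(n,\bar P),\mathrm{Mult}(n,\bar Q)\big),$$ where, for a probability measure $P$ on $\Omega$, $\mathrm{Mult}(n,P)$ is the multinomial distribution, i.e. the probability measure on the count vectors $k\in\mathbb N_0^{\Omega}$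 with $\sum_{\omega\in\Omega}k_\omega=n$ that gives $k$ the mass $\frac{n!}{\prod_{\omega}k_\omega!}\prod_{\omega}P(\{\omega\})^{k_\omega}$. -/

import Mathlib

open MeasureTheory
open scoped ENNReal

noncomputable section

/-- Total variation distance of two probability measures:
the supremum of `|μ E - ν E|` over all measurable sets `E`. -/
def tvDist {α : Type*} [MeasurableSpace α] (μ ν : Measure α) : ℝ :=
  ⨆ E : {E : Set α // MeasurableSet E}, |μ.real E.1 - ν.real E.1|

/-- The average `(1/n) ∑ P i` of the measures `P 0, …, P (n - 1)`. -/
def avgMeasure {Ω : Type*} [MeasurableSpace Ω] {n : ℕ} (P : Fin n → Measure Ω) : Measure Ω :=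
  (n : ℝ≥0∞)⁻¹ • ∑ i, P i

/-- The multinomial distribution with `n` trials and cell probabilities `P {ω}`, `ω ∈ Ω`,
on the count vectors `k : Ω → ℕ`: a vector `k` with `∑ ω, k ω = n` has the mass
`n! / ∏ ω, (k ω)! * ∏ ω, P {ω} ^ k ω`, all other vectors have mass zero. -/
def multinomialMeasure {Ω : Type*} [Fintype Ω] [MeasurableSpace Ω] (n : ℕ) (P : Measure Ω) :
    Measure (Ω → ℕ) :=
  open scoped Classical in
  ∑ k ∈ Finset.piAntidiag Finset.univ n,
    ((Nat.multinomial Finset.univ k : ℝ≥0∞) * ∏ ω, P {ω} ^ k ω) • Measure.dirac k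

end

/-!
Write `F` for the distance of `⨂ P i` and `⨂ Q i`. Replace each pair `P i`, `Q i` by the pair
`P i ⊗ Q i`, `Q i ⊗ P i`, which is exchanged by the swap of coordinates. The distance of the
products becomes some `F'` with `F ≤ F' ≤ 2 F` (`tvDist_pi_le_tvDist_pi_prod`,
`tvDist_pi_prod_le`). Relative to a swap-invariant probability measure `W i`, the new pair has
densities `1 + r i` and `1 - r i` with `r i` odd under the swap (`exists_odd_density`). Averaging
over all swaps therefore shows that `F' = 𝔼 f(r 1 (z 1), …, r n (z n))` for independent `z i` with
laws `W i`, where `f(a)` is the distance between the laws of independent signs with means `a i` and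
with means `-a i` (`tvDist_pi_eq_integral_signTV`).

For signs, `0.298 g ≤ f(a) ≤ g` with `g = √(1 - ∏ i, (1 - a i ^ 2))` (`le_signTV`, `signTV_le`).
The upper bound is the one by the Hellinger affinity. The lower bound is a fourth moment argument
when the product is close to `1`, and again the affinity otherwise.

It remains to compare `𝔼 √(1 - ∏ b i)` for independent `b i = 1 - r i ^ 2` with the same quantity
after the indices are redrawn independently and uniformly. Since `1 - √(1 - x)` is a power series
with nonnegative coefficients, and `𝔼 ∏ b i ^ k = ∏ 𝔼 b i ^ k`, the inequality of arithmetic and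
geometric means shows that redrawing can only decrease it (`sum_integral_sqrt_le`). The redrawn
quantity bounds the distance of the powers of the averages, because these powers are mixtures of the
redrawn products (`tvDist_pi_avgMeasure_le`). Altogether the constant is `0.298 / 2 = 0.149`.

For finite `Ω` the multinomial distribution is the law of the letter counts of a word under the
product measure, and these are a sufficient statistic
(`tvDist_pi_eq_tvDist_multinomialMeasure`).
-/

/-! ### Sign averages -/

/-- The number `1` or `-1` encoded by a Boolean. -/
def boolSign (b : Bool) : ℝ := if b then 1 else -1

/-- The likelihood of the sign vector `ε` under independent signs with means `a i`,
relative to independent uniform signs. -/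
def signLik {ι : Type*} [Fintype ι] (a : ι → ℝ) (ε : ι → Bool) : ℝ :=
  ∏ i, (1 + boolSign (ε i) * a i)

section SignAverage

variable {ι : Type*} [Fintype ι]

theorem sum_prod_bool [DecidableEq ι] (g : ι → Bool → ℝ) :
    ∑ ε : ι → Bool, ∏ i, g i (ε i) = ∏ i, (g i true + g i false) := by
  rw [← Fintype.prod_sum]
  simp

theorem sum_signLik_pow [DecidableEq ι] (a : ι → ℝ) (k : ℕ) :
    ∑ ε, signLik a ε ^ k = 2 ^ Fintype.card ι * ∏ i, (((1 + a i) ^ k + (1 - a i) ^ k) / 2) := by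
  simp_rw [signLik, ← Finset.prod_pow]
  rw [sum_prod_bool (fun i b => (1 + boolSign b * a i) ^ k), ← Finset.card_univ,
    ← Finset.prod_const, ← Finset.prod_mul_distrib]
  refine Finset.prod_congr rfl fun i _ => ?_
  simp [boolSign]
  ring

theorem signLik_nonneg {a : ι → ℝ} (ha : ∀ i, |a i| ≤ 1) (ε : ι → Bool) : 0 ≤ signLik a ε := by
  refine Finset.prod_nonneg fun i _ => ?_
  have := abs_le.1 (ha i)
  cases ε i <;> simp [boolSign] <;> linarith

theorem signLik_mul_signLik_neg (a : ι → ℝ) (ε : ι → Bool) :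
    signLik a ε * signLik (-a) ε = ∏ i, (1 - a i ^ 2) := by
  rw [signLik, signLik, ← Finset.prod_mul_distrib]
  refine Finset.prod_congr rfl fun i _ => ?_
  cases ε i <;> simp [boolSign] <;> ring

/-- The total variation distance between the laws of independent signs with means `a i` and with
means `-a i`. -/
noncomputable def signTV [DecidableEq ι] (a : ι → ℝ) : ℝ :=
  (2 ^ Fintype.card ι)⁻¹ * ∑ ε, |signLik a ε - signLik (-a) ε| / 2

theorem prod_one_sub_sq_mem {a : ι → ℝ} (ha : ∀ i, |a i| ≤ 1) :
    ∏ i, (1 - a i ^ 2) ∈ Set.Icc (0 : ℝ) 1 := by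
  have h : ∀ i, 0 ≤ 1 - a i ^ 2 := fun i => by
    have := (sq_le_one_iff_abs_le_one (a i)).2 (ha i); linarith
  exact ⟨Finset.prod_nonneg fun i _ => h i,
    Finset.prod_le_one (fun i _ => h i) fun i _ => by have := sq_nonneg (a i); linarith⟩

theorem sum_signLik [DecidableEq ι] (a : ι → ℝ) :
    ∑ ε, signLik a ε = 2 ^ Fintype.card ι := by
  have := sum_signLik_pow a 1
  simpa using this

theorem sum_signLik_sq [DecidableEq ι] (a : ι → ℝ) :
    ∑ ε, signLik a ε ^ 2 = 2 ^ Fintype.card ι * ∏ i, (1 + a i ^ 2) := by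
  rw [sum_signLik_pow]
  congr 1
  exact Finset.prod_congr rfl fun i _ => by ring

theorem sum_signLik_pow_four [DecidableEq ι] (a : ι → ℝ) :
    ∑ ε, signLik a ε ^ 4 = 2 ^ Fintype.card ι * ∏ i, (1 + 6 * a i ^ 2 + a i ^ 4) := by
  rw [sum_signLik_pow]
  congr 1
  exact Finset.prod_congr rfl fun i _ => by ring

/-- With `A`, `B` the two likelihoods, `K = A * B` does not depend on the signs, so
`|A - B| / 2 = √(y ^ 2 - K)` for `y = (A + B) / 2`, which has mean `1`. This function of `y` is
concave and lies below its tangent at `y = 1`. -/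
theorem signTV_le [DecidableEq ι] {a : ι → ℝ} (ha : ∀ i, |a i| ≤ 1) :
    signTV a ≤ √(1 - ∏ i, (1 - a i ^ 2)) := by
  obtain ⟨hK0, hK1⟩ := prod_one_sub_sq_mem ha
  set K := ∏ i, (1 - a i ^ 2) with hK
  set N : ℝ := 2 ^ Fintype.card ι with hN
  have hNpos : 0 < N := by positivity
  have hneg : ∀ i, |(-a) i| ≤ 1 := fun i => by simpa using ha i
  set t := √(1 - K) with ht
  have ht0 : 0 ≤ t := Real.sqrt_nonneg _
  have ht2 : t ^ 2 = 1 - K := Real.sq_sqrt (by linarith)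
  have key : ∀ ε : ι → Bool,
      |signLik a ε - signLik (-a) ε| / 2 * t ≤ (signLik a ε + signLik (-a) ε) / 2 - K := by
    intro ε
    have h1 := signLik_nonneg ha ε
    have h2 := signLik_nonneg hneg ε
    have h3 : signLik a ε * signLik (-a) ε = K := signLik_mul_signLik_neg a ε
    set A := signLik a ε
    set B := signLik (-a) ε
    have hy : K ≤ (A + B) / 2 := by nlinarith [sq_nonneg (A - B)]
    refine abs_le_of_sq_le_sq' ?_ (by linarith) |>.2
    rw [mul_pow, div_pow, sq_abs, ht2]
    have : (A - B) ^ 2 = (A + B) ^ 2 - 4 * K := by rw [← h3]; ring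
    rw [this]
    nlinarith [mul_nonneg hK0 (sq_nonneg (1 - (A + B) / 2))]
  have hsum : (∑ ε, |signLik a ε - signLik (-a) ε| / 2) * t ≤ N * t ^ 2 := by
    rw [Finset.sum_mul]
    refine (Finset.sum_le_sum fun ε _ => key ε).trans (le_of_eq ?_)
    rw [Finset.sum_sub_distrib, ← Finset.sum_div, Finset.sum_add_distrib, sum_signLik,
      sum_signLik, ht2]
    simp [hN]
    ring
  rw [signTV, inv_mul_le_iff₀ hNpos]
  rcases ht0.eq_or_lt with h0 | h0
  · -- here `K = 1`, so that all `A = B`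
    refine (Finset.sum_nonpos fun ε _ => ?_).trans (by positivity)
    have h1 := signLik_nonneg ha ε
    have h2 := signLik_nonneg hneg ε
    by_contra hcon
    have hK1 : K = 1 := by rw [← h0] at ht2; linarith
    have : ∀ i, a i = 0 := by
      intro i
      by_contra hi
      have : K < 1 := by
        rw [hK]
        classical
        rw [← Finset.mul_prod_erase _ _ (Finset.mem_univ i)]
        have e1 : ∏ j ∈ Finset.univ.erase i, (1 - a j ^ 2) ≤ 1 :=
          Finset.prod_le_one (fun j _ => by
            have := (sq_le_one_iff_abs_le_one (a j)).2 (ha j); linarith)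
            fun j _ => by have := sq_nonneg (a j); linarith
        have e2 : 0 < a i ^ 2 := by positivity
        have e3 := (sq_le_one_iff_abs_le_one (a i)).2 (ha i)
        nlinarith
      linarith
    apply hcon
    have : a = 0 := funext this
    simp [this]
  · have : (∑ ε, |signLik a ε - signLik (-a) ε| / 2) * t ≤ (N * t) * t := by
      linarith [hsum, (by ring : N * t ^ 2 = N * t * t)]
    exact le_of_mul_le_mul_right this h0

theorem prod_quartic_mul_le_one {a : ι → ℝ} (ha : ∀ i, |a i| ≤ 1) :
    (∏ i, (1 + 6 * a i ^ 2 + a i ^ 4)) * (∏ i, (1 - a i ^ 2)) ^ 6 ≤ 1 := by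
  rw [← Finset.prod_pow, ← Finset.prod_mul_distrib]
  have h : ∀ i, 0 ≤ 1 - a i ^ 2 := fun i => by
    have := (sq_le_one_iff_abs_le_one (a i)).2 (ha i); linarith
  refine Finset.prod_le_one (fun i _ => ?_) fun i _ => ?_
  · have := h i; positivity
  · have hi := h i
    have hx : 0 ≤ a i ^ 2 := sq_nonneg _
    have e : a i ^ 4 = (a i ^ 2) ^ 2 := by ring
    rw [e]
    generalize a i ^ 2 = x at *
    calc (1 + 6 * x + x ^ 2) * (1 - x) ^ 6 ≤ (1 + x) ^ 6 * (1 - x) ^ 6 := by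
          gcongr
          nlinarith [pow_nonneg hx 2, pow_nonneg hx 3, pow_nonneg hx 4, pow_nonneg hx 5,
            pow_nonneg hx 6]
      _ = (1 - x ^ 2) ^ 6 := by rw [← mul_pow]; ring
      _ ≤ 1 := pow_le_one₀ (by nlinarith) (by nlinarith)

theorem one_le_one_sub_pow_six_mul {s : ℝ} (h0 : 0 ≤ s) (h1 : s ≤ 0.32) :
    1 ≤ (1 - s) ^ 6 * (1 + 6 * s + 81 * s ^ 2) := by
  have e1 : 1 ≤ (1 - s) ^ 3 * (1 + 3 * s + 13 * s ^ 2) := by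
    have : 0 ≤ 7 - 31 * s + 36 * s ^ 2 - 13 * s ^ 3 := by
      nlinarith [mul_nonneg h0 (sub_nonneg.2 h1), mul_nonneg (mul_nonneg h0 h0) (sub_nonneg.2 h1),
        sq_nonneg (0.32 - s)]
    nlinarith [mul_nonneg (sq_nonneg s) this]
  have e2 : (1 + 3 * s + 13 * s ^ 2) ^ 2 ≤ 1 + 6 * s + 81 * s ^ 2 := by
    have : 0 ≤ 46 - 78 * s - 169 * s ^ 2 := by nlinarith
    nlinarith [mul_nonneg (sq_nonneg s) this]
  calc (1 : ℝ) ≤ ((1 - s) ^ 3 * (1 + 3 * s + 13 * s ^ 2)) ^ 2 := one_le_pow₀ e1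
    _ = (1 - s) ^ 6 * (1 + 3 * s + 13 * s ^ 2) ^ 2 := by ring
    _ ≤ _ := by gcongr

/-- The bound `|A - B| / 2 ≥ y - √K` settles the case where `K` is far from `1`. Otherwise the
bound `D ≥ α D ^ 2 - β D ^ 4`, valid for `β ≥ 4 α ^ 3 / 27`, reduces the claim to the second and
fourth moments of `D = |A - B| / 2`. -/
theorem le_signTV [DecidableEq ι] {a : ι → ℝ} (ha : ∀ i, |a i| ≤ 1) :
    0.298 * √(1 - ∏ i, (1 - a i ^ 2)) ≤ signTV a := by
  obtain ⟨hK0, hK1⟩ := prod_one_sub_sq_mem ha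
  have hneg : ∀ i, |(-a) i| ≤ 1 := fun i => by simpa using ha i
  have hQ := prod_quartic_mul_le_one ha
  have m1 := sum_signLik a
  have m1' := sum_signLik (-a)
  have m2 := sum_signLik_sq a
  have m2' := sum_signLik_sq (-a)
  have m4 := sum_signLik_pow_four a
  have m4' := sum_signLik_pow_four (-a)
  have hAB : ∀ ε, signLik a ε * signLik (-a) ε = ∏ i, (1 - a i ^ 2) :=
    signLik_mul_signLik_neg a
  have hA := signLik_nonneg ha
  have hB := signLik_nonneg hneg
  simp only [Pi.neg_apply, neg_sq, Even.neg_pow (show Even 4 by decide)] at m2' m4'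
  have hQ0 : 0 ≤ ∏ i, (1 + 6 * a i ^ 2 + a i ^ 4) := Finset.prod_nonneg fun i _ => by positivity
  rw [signTV, le_inv_mul_iff₀ (by positivity)]
  have hNcard : ((Fintype.card (ι → Bool) : ℕ) : ℝ) = 2 ^ Fintype.card ι := by simp
  set N : ℝ := 2 ^ Fintype.card ι with hN
  have hNpos : 0 < N := by positivity
  set K := ∏ i, (1 - a i ^ 2) with hK
  set R := ∏ i, (1 + a i ^ 2)
  set Q := ∏ i, (1 + 6 * a i ^ 2 + a i ^ 4)
  have hconst : ∀ c : ℝ, ∑ _ε : ι → Bool, c = N * c := fun c => by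
    rw [Finset.sum_const, nsmul_eq_mul, Finset.card_univ, hNcard]
  rcases le_or_gt K 0.68 with hcase | hcase
  · set k := √K with hk
    have hk0 : 0 ≤ k := Real.sqrt_nonneg _
    have hk2 : k ^ 2 = K := Real.sq_sqrt hK0
    have hk1 : k ≤ 0.825 := by
      refine abs_le_of_sq_le_sq' ?_ (by norm_num) |>.2
      rw [hk2]; norm_num; linarith
    have hD : ∀ ε, (signLik a ε + signLik (-a) ε) / 2 - k ≤
        |signLik a ε - signLik (-a) ε| / 2 := by
      intro ε
      have h1 := hA ε
      have h2 := hB ε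
      have h3 := hAB ε
      set A := signLik a ε
      set B := signLik (-a) ε
      have hy : k ≤ (A + B) / 2 := by
        refine abs_le_of_sq_le_sq' ?_ (by linarith) |>.2
        nlinarith [sq_nonneg (A - B)]
      refine abs_le_of_sq_le_sq' ?_ (by positivity) |>.2
      rw [div_pow |A - B|, sq_abs]
      nlinarith
    have h1 : N * (1 - k) ≤ ∑ ε, |signLik a ε - signLik (-a) ε| / 2 := by
      refine le_trans (le_of_eq ?_) (Finset.sum_le_sum fun ε _ => hD ε)
      rw [Finset.sum_sub_distrib, ← Finset.sum_div, Finset.sum_add_distrib, m1, m1', hconst]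
      ring
    refine le_trans ?_ h1
    gcongr
    have : √(1 - K) ≤ (1 - k) / 0.298 := by
      rw [Real.sqrt_le_left (by apply div_nonneg <;> norm_num; linarith), div_pow,
        le_div_iff₀ (by norm_num), ← hk2]
      nlinarith
    rw [le_div_iff₀ (by norm_num)] at this
    linarith
  · set σ := √(1 - K) with hσ
    have hσ0 : 0 ≤ σ := Real.sqrt_nonneg _
    have hσ2 : σ ^ 2 = 1 - K := Real.sq_sqrt (by linarith)
    rcases hσ0.eq_or_lt with h0 | hσpos
    · rw [← h0]
      simp only [mul_zero]
      exact Finset.sum_nonneg fun ε _ => by positivity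
    -- `R + K ≥ 2`, because `y = (A + B) / 2` has mean `1` and second moment `(R + K) / 2`
    have hR : 2 - K ≤ R := by
      have h : 0 ≤ ∑ ε, ((signLik a ε + signLik (-a) ε) / 2 - 1) ^ 2 :=
        Finset.sum_nonneg fun ε _ => sq_nonneg _
      have e : ∀ ε, ((signLik a ε + signLik (-a) ε) / 2 - 1) ^ 2 =
          (signLik a ε ^ 2 + signLik (-a) ε ^ 2) / 4 - (signLik a ε + signLik (-a) ε)
            + (K / 2 + 1) := fun ε => by rw [← hAB ε]; ring
      simp_rw [e] at h
      rw [Finset.sum_add_distrib, Finset.sum_sub_distrib, ← Finset.sum_div,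
        Finset.sum_add_distrib, Finset.sum_add_distrib, m1, m1', m2, m2', hconst] at h
      nlinarith
    have hQle : Q ≤ 1 + 6 * (1 - K) + 81 * (1 - K) ^ 2 := by
      have e := one_le_one_sub_pow_six_mul (s := 1 - K) (by linarith) (by norm_num; linarith)
      rw [sub_sub_cancel] at e
      calc Q ≤ Q * (K ^ 6 * (1 + 6 * (1 - K) + 81 * (1 - K) ^ 2)) := le_mul_of_one_le_right hQ0 e
        _ = (Q * K ^ 6) * (1 + 6 * (1 - K) + 81 * (1 - K) ^ 2) := by ring
        _ ≤ 1 * (1 + 6 * (1 - K) + 81 * (1 - K) ^ 2) := by gcongr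
        _ = _ := one_mul _
    -- nearly optimal, given the moment bounds `E D ^ 2 ≥ σ ^ 2` and `E D ^ 4 ≤ 11 σ ^ 4`
    set α := 0.45 / σ with hα
    have hα0 : 0 ≤ α := by positivity
    have hασ : α * σ = 0.45 := by rw [hα]; field_simp
    have hD : ∀ ε, α * ((signLik a ε ^ 2 + signLik (-a) ε ^ 2) / 4 - K / 2) - 4 * α ^ 3 / 27 *
        ((signLik a ε ^ 4 + signLik (-a) ε ^ 4) / 16 -
          K / 4 * (signLik a ε ^ 2 + signLik (-a) ε ^ 2) + 3 * K ^ 2 / 8) ≤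
        |signLik a ε - signLik (-a) ε| / 2 := by
      intro ε
      have h3 := hAB ε
      set A := signLik a ε
      set B := signLik (-a) ε
      have e1 : (A ^ 2 + B ^ 2) / 4 - K / 2 = (|A - B| / 2) ^ 2 := by
        rw [div_pow, sq_abs, ← h3]; ring
      have e2 : (A ^ 4 + B ^ 4) / 16 - K / 4 * (A ^ 2 + B ^ 2) + 3 * K ^ 2 / 8 =
          ((|A - B| / 2) ^ 2) ^ 2 := by
        rw [div_pow, sq_abs, ← h3]; ring
      rw [e1, e2]
      have hd : 0 ≤ |A - B| / 2 := by positivity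
      generalize |A - B| / 2 = d at hd
      have : 0 ≤ d * ((2 * (α * d) - 3) ^ 2 * (α * d + 3)) := by positivity
      nlinarith
    have h1 : N * (α * ((R - K) / 2) - 4 * α ^ 3 / 27 * ((Q - 4 * K * R + 3 * K ^ 2) / 8)) ≤
        ∑ ε, |signLik a ε - signLik (-a) ε| / 2 := by
      refine le_trans (le_of_eq ?_) (Finset.sum_le_sum fun ε _ => hD ε)
      rw [Finset.sum_sub_distrib, ← Finset.mul_sum, ← Finset.mul_sum, Finset.sum_sub_distrib,
        Finset.sum_add_distrib, Finset.sum_sub_distrib, ← Finset.sum_div, ← Finset.sum_div,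
        ← Finset.sum_div, ← Finset.mul_sum, Finset.sum_add_distrib, Finset.sum_add_distrib,
        m2, m2', m4, m4', hconst, hconst]
      ring
    refine le_trans ?_ h1
    gcongr
    have b1 : σ ^ 2 ≤ (R - K) / 2 := by linarith
    have b2 : (Q - 4 * K * R + 3 * K ^ 2) / 8 ≤ 11 * (σ ^ 2) ^ 2 := by
      rw [hσ2]
      nlinarith [mul_le_mul_of_nonneg_left hR hK0]
    calc 0.298 * σ ≤ α * σ * σ - 4 * (α * σ) ^ 3 / 27 * (11 * σ) := by
          rw [hασ]; norm_num; linarith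
      _ = α * σ ^ 2 - 4 * α ^ 3 / 27 * (11 * (σ ^ 2) ^ 2) := by ring
      _ ≤ _ := by gcongr

end SignAverage

/-! ### Total variation distance -/

section TotalVariation

variable {α β : Type*} [MeasurableSpace α] [MeasurableSpace β]

theorem abs_sub_le_tvDist (μ ν : Measure α) [IsProbabilityMeasure μ] [IsProbabilityMeasure ν]
    {E : Set α} (hE : MeasurableSet E) : |μ.real E - ν.real E| ≤ tvDist μ ν := by
  refine le_ciSup (f := fun E : {E : Set α // MeasurableSet E} => |μ.real E.1 - ν.real E.1|)
    ⟨1, ?_⟩ ⟨E, hE⟩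
  rintro _ ⟨F, rfl⟩
  have h1 := measureReal_le_one (μ := μ) (s := F.1)
  have h2 := measureReal_le_one (μ := ν) (s := F.1)
  have h3 := measureReal_nonneg (μ := μ) (s := F.1)
  have h4 := measureReal_nonneg (μ := ν) (s := F.1)
  exact abs_le.2 ⟨by linarith, by linarith⟩

theorem tvDist_le {μ ν : Measure α} {c : ℝ}
    (h : ∀ E, MeasurableSet E → |μ.real E - ν.real E| ≤ c) : tvDist μ ν ≤ c :=
  have : Nonempty {E : Set α // MeasurableSet E} := ⟨⟨∅, .empty⟩⟩
  ciSup_le fun E => h E.1 E.2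

theorem tvDist_map_le (μ ν : Measure α) [IsProbabilityMeasure μ] [IsProbabilityMeasure ν]
    {f : α → β} (hf : Measurable f) : tvDist (μ.map f) (ν.map f) ≤ tvDist μ ν := by
  refine tvDist_le fun E hE => ?_
  rw [map_measureReal_apply hf hE, map_measureReal_apply hf hE]
  exact abs_sub_le_tvDist μ ν (hf hE)

theorem measureReal_withDensity_ofReal {m : Measure α} {f : α → ℝ} (hf : Integrable f m)
    (hf0 : ∀ x, 0 ≤ f x) {E : Set α} (hE : MeasurableSet E) :
    (m.withDensity fun x => ENNReal.ofReal (f x)).real E = ∫ x in E, f x ∂m := by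
  rw [measureReal_def, withDensity_apply _ hE,
    integral_eq_lintegral_of_nonneg_ae (.of_forall hf0) hf.aestronglyMeasurable.restrict]

theorem tvDist_withDensity {m : Measure α} {f g : α → ℝ} (hf : Integrable f m)
    (hg : Integrable g m) (hfm : Measurable f) (hgm : Measurable g)
    (hf0 : ∀ x, 0 ≤ f x) (hg0 : ∀ x, 0 ≤ g x)
    [IsProbabilityMeasure (m.withDensity fun x => ENNReal.ofReal (f x))]
    [IsProbabilityMeasure (m.withDensity fun x => ENNReal.ofReal (g x))] :
    tvDist (m.withDensity fun x => ENNReal.ofReal (f x))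
      (m.withDensity fun x => ENNReal.ofReal (g x)) = ∫ x, |f x - g x| / 2 ∂m := by
  have hint : Integrable (fun x => f x - g x) m := hf.sub hg
  have htot : ∫ x, (f x - g x) ∂m = 0 := by
    have h1 := measureReal_withDensity_ofReal hf hf0 .univ
    have h2 := measureReal_withDensity_ofReal hg hg0 .univ
    rw [probReal_univ, setIntegral_univ] at h1 h2
    rw [integral_sub hf hg, ← h1, ← h2, sub_self]
  have hval : ∀ E, MeasurableSet E →
      (m.withDensity fun x => ENNReal.ofReal (f x)).real E -
        (m.withDensity fun x => ENNReal.ofReal (g x)).real E = ∫ x in E, (f x - g x) ∂m := by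
    intro E hE
    rw [measureReal_withDensity_ofReal hf hf0 hE, measureReal_withDensity_ofReal hg hg0 hE,
      integral_sub hf.integrableOn hg.integrableOn]
  have hcompl : ∀ E, MeasurableSet E →
      ∫ x in E, (f x - g x) ∂m + ∫ x in Eᶜ, (f x - g x) ∂m = 0 := fun E hE => by
    rw [integral_add_compl hE hint, htot]
  rw [integral_div]
  apply le_antisymm
  · refine tvDist_le fun E hE => ?_
    rw [hval E hE]
    have h1 := norm_integral_le_integral_norm (μ := m.restrict E) fun x => f x - g x
    have h2 := norm_integral_le_integral_norm (μ := m.restrict Eᶜ) fun x => f x - g x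
    simp only [Real.norm_eq_abs] at h1 h2
    have h3 := integral_add_compl hE hint.abs
    have h4 := hcompl E hE
    rw [eq_neg_of_add_eq_zero_right h4, abs_neg] at h2
    linarith
  · set E : Set α := {x | 0 ≤ f x - g x}
    have hE : MeasurableSet E := measurableSet_le measurable_const (hfm.sub hgm)
    have h1 : ∫ x in E, |f x - g x| ∂m = ∫ x in E, (f x - g x) ∂m :=
      setIntegral_congr_fun hE fun x hx => abs_of_nonneg hx
    have h2 : ∫ x in Eᶜ, |f x - g x| ∂m = - ∫ x in Eᶜ, (f x - g x) ∂m := by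
      rw [← integral_neg]
      exact setIntegral_congr_fun hE.compl fun x hx => abs_of_nonpos (le_of_not_ge hx)
    have h3 := integral_add_compl hE hint.abs
    have h4 := hcompl E hE
    have h5 := abs_sub_le_tvDist (m.withDensity fun x => ENNReal.ofReal (f x))
      (m.withDensity fun x => ENNReal.ofReal (g x)) hE
    rw [hval E hE] at h5
    have h6 := le_abs_self (∫ x in E, (f x - g x) ∂m)
    linarith

end TotalVariation

section ProductDensity

variable {ι : Type*} [Fintype ι] {Z : Type*} [MeasurableSpace Z]

theorem pi_withDensity_ofReal (W : ι → Measure Z) [∀ i, IsProbabilityMeasure (W i)]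
    {f : ι → Z → ℝ} (hf : ∀ i, Integrable (f i) (W i)) (hf0 : ∀ i z, 0 ≤ f i z) :
    (Measure.pi fun i => (W i).withDensity fun z => ENNReal.ofReal (f i z)) =
      (Measure.pi W).withDensity fun z => ENNReal.ofReal (∏ i, f i (z i)) := by
  have : ∀ i, IsFiniteMeasure ((W i).withDensity fun z => ENNReal.ofReal (f i z)) :=
    fun i => isFiniteMeasure_withDensity_ofReal (hf i).2
  refine Measure.pi_eq fun s hs => ?_
  rw [withDensity_apply _ (MeasurableSet.univ_pi hs), Measure.restrict_pi_pi,
    ← ofReal_integral_eq_lintegral_ofReal, integral_fintype_prod_eq_prod,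
    ENNReal.ofReal_prod_of_nonneg fun i _ => integral_nonneg (hf0 i)]
  · refine Finset.prod_congr rfl fun i _ => ?_
    rw [withDensity_apply _ (hs i), ofReal_integral_eq_lintegral_ofReal (hf i).integrableOn
      (.of_forall (hf0 i))]
  · exact Integrable.fintype_prod fun i => (hf i).integrableOn
  · exact .of_forall fun z => Finset.prod_nonneg fun i _ => hf0 i _

end ProductDensity

/-! ### Symmetric pairs of measures -/

section Symmetric

variable {Z : Type*} [MeasurableSpace Z]

theorem withDensity_map_of_involutive {S : Measure Z} {τ : Z → Z} (hτ : MeasurePreserving τ S S)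
    (hinv : Function.Involutive τ) {f : Z → ℝ≥0∞} (hf : Measurable f) :
    (S.withDensity f).map τ = S.withDensity fun z => f (τ z) := by
  ext E hE
  rw [Measure.map_apply hτ.measurable hE, withDensity_apply _ (hτ.measurable hE),
    withDensity_apply _ hE,
    ← hτ.setLIntegral_comp_preimage hE (f := fun z => f (τ z)) (hf.comp hτ.measurable)]
  simp only [hinv _]

/-- If an involution exchanges `A` and `B`, then relative to their average they have densities
`1 + r` and `1 - r` with a function `r` that is odd, everywhere and not just almost everywhere.
For this take `k = dA/d(A+B)` and `r z = k z - k (τ z)`: both `k z` and `1 - k (τ z)` are versions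
of the same density. -/
theorem exists_odd_density (A B : Measure Z) [IsProbabilityMeasure A] [IsProbabilityMeasure B]
    {τ : Z → Z} (hτ : Measurable τ) (hinv : Function.Involutive τ) (hAB : A.map τ = B) :
    ∃ (W : Measure Z) (r : Z → ℝ), IsProbabilityMeasure W ∧ MeasurePreserving τ W W ∧
      Measurable r ∧ (∀ z, |r z| ≤ 1) ∧ (∀ z, r (τ z) = - r z) ∧
      A = W.withDensity (fun z => ENNReal.ofReal (1 + r z)) ∧
      B = W.withDensity (fun z => ENNReal.ofReal (1 - r z)) := by
  have hBA : B.map τ = A := by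
    rw [← hAB, Measure.map_map hτ hτ, hinv.comp_self, Measure.map_id]
  set S := A + B with hS
  have hτS : MeasurePreserving τ S S :=
    ⟨hτ, by rw [hS, Measure.map_add _ _ hτ, hAB, hBA, add_comm]⟩
  set k : Z → ℝ := fun z => (min (A.rnDeriv S z) 1).toReal with hk
  have hkm : Measurable k := ((Measure.measurable_rnDeriv A S).min measurable_const).ennreal_toReal
  have hk0 : ∀ z, 0 ≤ k z := fun z => ENNReal.toReal_nonneg
  have hk1 : ∀ z, k z ≤ 1 := fun z => by
    have := ENNReal.toReal_mono ENNReal.one_ne_top (min_le_right (A.rnDeriv S z) 1)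
    simpa using this
  have hAS : A ≤ S := Measure.le_add_right le_rfl
  have hA1 : A = S.withDensity fun z => ENNReal.ofReal (k z) := by
    conv_lhs => rw [← Measure.withDensity_rnDeriv_eq A S (Measure.absolutelyContinuous_of_le hAS)]
    refine withDensity_congr_ae ?_
    filter_upwards [Measure.rnDeriv_le_one_of_le hAS] with z hz
    rw [hk]
    dsimp only
    rw [ENNReal.ofReal_toReal (by simp), min_eq_left (by simpa using hz)]
  have hB1 : B = S.withDensity fun z => ENNReal.ofReal (1 - k z) := by
    have h : A + S.withDensity (fun z => ENNReal.ofReal (1 - k z)) = A + B := by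
      conv_lhs => rw [hA1]
      rw [← withDensity_add_left hkm.ennreal_ofReal]
      have : ((fun z => ENNReal.ofReal (k z)) + fun z => ENNReal.ofReal (1 - k z)) = 1 := by
        ext z
        simp only [Pi.add_apply, Pi.one_apply]
        rw [← ENNReal.ofReal_add (hk0 z) (by linarith [hk1 z])]
        simp
      rw [this, withDensity_one]
    ext E hE
    have := congrArg (fun m : Measure Z => m E) h
    simp only [Measure.add_apply] at this
    exact ((ENNReal.add_right_inj (measure_ne_top A E)).1 this).symm
  have hA2 : A = S.withDensity fun z => ENNReal.ofReal (1 - k (τ z)) := by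
    rw [← hBA]
    conv_lhs => rw [hB1]
    exact withDensity_map_of_involutive hτS hinv (measurable_const.sub hkm).ennreal_ofReal
  set W : Measure Z := (2⁻¹ : ℝ≥0∞) • S with hW
  have hWτ : MeasurePreserving τ W W := ⟨hτ, by rw [hW, Measure.map_smul, hτS.map_eq]⟩
  have hWp : IsProbabilityMeasure W := ⟨by
    rw [hW, hS]
    simp [ENNReal.inv_two_add_inv_two]⟩
  have hrm : Measurable fun z => k z - k (τ z) := hkm.sub (hkm.comp hτ)
  have hA : A = W.withDensity (fun z => ENNReal.ofReal (1 + (k z - k (τ z)))) := by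
    have e : (fun z => ENNReal.ofReal (1 + (k z - k (τ z)))) =
        (fun z => ENNReal.ofReal (k z)) + fun z => ENNReal.ofReal (1 - k (τ z)) := by
      ext z
      simp only [Pi.add_apply]
      rw [← ENNReal.ofReal_add (hk0 z) (by linarith [hk1 (τ z)])]
      congr 1
      ring
    rw [e, hW, withDensity_smul_measure, withDensity_add_left hkm.ennreal_ofReal, ← hA1, ← hA2,
      ← two_smul ℝ≥0∞ A, smul_smul, ENNReal.inv_mul_cancel (by simp) (by simp), one_smul]
  refine ⟨W, fun z => k z - k (τ z), hWp, hWτ, hrm, fun z => ?_, fun z => ?_, hA, ?_⟩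
  · rw [abs_le]
    have := hk0 z; have := hk1 z; have := hk0 (τ z); have := hk1 (τ z)
    constructor <;> linarith
  · dsimp only
    rw [hinv z]
    ring
  · rw [← hAB]
    conv_lhs => rw [hA]
    rw [withDensity_map_of_involutive hWτ hinv
      (f := fun z => ENNReal.ofReal (1 + (k z - k (τ z)))) (measurable_const.add hrm).ennreal_ofReal]
    congr 1
    ext z
    rw [hinv z]
    congr 1
    ring

theorem measurable_signLik {ι X : Type*} [Fintype ι] [MeasurableSpace X] {a : X → ι → ℝ}
    (ha : ∀ i, Measurable fun x => a x i) (ε : ι → Bool) :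
    Measurable fun x => signLik (a x) ε := by
  unfold signLik
  fun_prop

theorem abs_signLik_le {ι : Type*} [Fintype ι] {a : ι → ℝ} (ha : ∀ i, |a i| ≤ 1)
    (ε : ι → Bool) : |signLik a ε| ≤ 2 ^ Fintype.card ι := by
  rw [signLik, Finset.abs_prod, ← Finset.card_univ, ← Finset.prod_const]
  refine Finset.prod_le_prod (fun _ _ => abs_nonneg _) fun i _ => ?_
  have := abs_le.1 (ha i)
  cases ε i <;> simp [boolSign] <;> rw [abs_le] <;> constructor <;> linarith

/-- For an odd density, averaging over all exchanges of coordinates shows that the total variation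
distance of the products is the mean distance of products of signs with random biases. -/
theorem tvDist_pi_eq_integral_signTV {ι : Type*} [Fintype ι] [DecidableEq ι]
    (W : ι → Measure Z) [∀ i, IsProbabilityMeasure (W i)] {τ : Z → Z} {r : ι → Z → ℝ}
    (hτ : ∀ i, MeasurePreserving τ (W i) (W i)) (hrm : ∀ i, Measurable (r i))
    (hr1 : ∀ i z, |r i z| ≤ 1) (hodd : ∀ i z, r i (τ z) = - r i z)
    {A B : ι → Measure Z} [∀ i, IsProbabilityMeasure (A i)] [∀ i, IsProbabilityMeasure (B i)]
    (hA : ∀ i, A i = (W i).withDensity (fun z => ENNReal.ofReal (1 + r i z)))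
    (hB : ∀ i, B i = (W i).withDensity (fun z => ENNReal.ofReal (1 - r i z))) :
    tvDist (Measure.pi A) (Measure.pi B) =
      ∫ z, signTV (fun i => r i (z i)) ∂(Measure.pi W) := by
  have hmeas : ∀ ε, Measurable fun z : ι → Z => signLik (fun i => r i (z i)) ε :=
    measurable_signLik (a := fun (z : ι → Z) i => r i (z i))
      fun i => (hrm i).comp (measurable_pi_apply i)
  have hmeas' : ∀ ε, Measurable fun z : ι → Z => signLik (-fun i => r i (z i)) ε :=
    measurable_signLik (a := fun (z : ι → Z) => -fun i => r i (z i))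
      fun i => ((hrm i).comp (measurable_pi_apply i)).neg
  have hint : ∀ ε, Integrable (fun z : ι → Z => signLik (fun i => r i (z i)) ε) (Measure.pi W) :=
    fun ε => .of_bound (hmeas ε).aestronglyMeasurable _
      (.of_forall fun z => abs_signLik_le (fun i => hr1 i (z i)) ε)
  have hint' : ∀ ε, Integrable (fun z : ι → Z => signLik (-fun i => r i (z i)) ε)
      (Measure.pi W) :=
    fun ε => .of_bound (hmeas' ε).aestronglyMeasurable _
      (.of_forall fun z => abs_signLik_le (fun i => by simpa using hr1 i (z i)) ε)
  have hApi : Measure.pi A = (Measure.pi W).withDensity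
      fun z => ENNReal.ofReal (signLik (fun i => r i (z i)) fun _ => true) := by
    rw [funext hA, pi_withDensity_ofReal W (f := fun i z => 1 + r i z)
      (fun i => (integrable_const 1).add (.of_bound (hrm i).aestronglyMeasurable 1
        (.of_forall (hr1 i)))) fun i z => by linarith [(abs_le.1 (hr1 i z)).1]]
    simp [signLik, boolSign]
  have hBpi : Measure.pi B = (Measure.pi W).withDensity
      fun z => ENNReal.ofReal (signLik (-fun i => r i (z i)) fun _ => true) := by
    rw [funext hB, pi_withDensity_ofReal W (f := fun i z => 1 - r i z)
      (fun i => (integrable_const 1).sub (.of_bound (hrm i).aestronglyMeasurable 1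
        (.of_forall (hr1 i)))) fun i z => by linarith [(abs_le.1 (hr1 i z)).2]]
    simp [signLik, boolSign, sub_eq_add_neg]
  have : IsProbabilityMeasure ((Measure.pi W).withDensity
      fun z => ENNReal.ofReal (signLik (fun i => r i (z i)) fun _ => true)) := by
    rw [← hApi]; infer_instance
  have : IsProbabilityMeasure ((Measure.pi W).withDensity
      fun z => ENNReal.ofReal (signLik (-fun i => r i (z i)) fun _ => true)) := by
    rw [← hBpi]; infer_instance
  rw [hApi, hBpi, tvDist_withDensity (hint _) (hint' _) (hmeas _) (hmeas' _)
    (fun z => signLik_nonneg (fun i => hr1 i (z i)) _)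
    (fun z => signLik_nonneg (fun i => by simpa using hr1 i (z i)) _)]
  -- exchanging the coordinates with `ε i = false` turns the density for all signs `+` into
  -- the density for the signs `ε`
  have hswap : ∀ ε : ι → Bool,
      ∫ z, |signLik (fun i => r i (z i)) ε - signLik (-fun i => r i (z i)) ε| / 2
        ∂(Measure.pi W) =
      ∫ z, |signLik (fun i => r i (z i)) (fun _ => true) -
        signLik (-fun i => r i (z i)) (fun _ => true)| / 2 ∂(Measure.pi W) := by
    intro ε
    set σ : ι → Z → Z := fun i => if ε i then id else τ with hσ
    have hσp : ∀ i, MeasurePreserving (σ i) (W i) (W i) := fun i => by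
      rw [hσ]
      dsimp only
      split_ifs
      exacts [.id _, hτ i]
    have hpi := measurePreserving_pi W W hσp
    have hchange := integral_map (μ := Measure.pi W) hpi.measurable.aemeasurable
      (f := fun z => |signLik (fun i => r i (z i)) (fun _ => true) -
        signLik (-fun i => r i (z i)) (fun _ => true)| / 2)
      ((((hmeas _).sub (hmeas' _)).abs.div_const 2).aestronglyMeasurable)
    rw [hpi.map_eq] at hchange
    rw [hchange]
    congr 1
    ext z
    have hrσ : ∀ i, r i (σ i (z i)) = boolSign (ε i) * r i (z i) := fun i => by
      rw [hσ]
      dsimp only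
      cases ε i <;> simp [boolSign, hodd]
    simp [signLik, hrσ, boolSign]
  simp only [signTV]
  have hint2 : ∀ ε ∈ Finset.univ, Integrable (fun z : ι → Z =>
      |signLik (fun i => r i (z i)) ε - signLik (-fun i => r i (z i)) ε| / 2) (Measure.pi W) :=
    fun ε _ => ((hint ε).sub (hint' ε)).abs.div_const 2
  rw [integral_const_mul, integral_finsetSum _ hint2, Finset.sum_congr rfl fun ε _ => hswap ε,
    Finset.sum_const, nsmul_eq_mul, Finset.card_univ, ← mul_assoc]
  simp

end Symmetric

/-! ### Mixing the factors of a product -/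

section Mixing

/-- Polynomials with nonnegative coefficients that increase to `1 - √(1 - x)` on `[0, 1]`: the
iterates of `h ↦ (x + h ^ 2) / 2`, whose smaller fixed point is `1 - √(1 - x)`. -/
noncomputable def oneSubSqrtPoly : ℕ → Polynomial ℝ
  | 0 => 0
  | k + 1 => Polynomial.C (1 / 2) * (Polynomial.X + oneSubSqrtPoly k * oneSubSqrtPoly k)

theorem oneSubSqrtPoly_coeff_nonneg (k j : ℕ) : 0 ≤ (oneSubSqrtPoly k).coeff j := by
  induction k generalizing j with
  | zero => simp [oneSubSqrtPoly]
  | succ k ih =>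
    rw [oneSubSqrtPoly, Polynomial.coeff_C_mul, Polynomial.coeff_add, Polynomial.coeff_X,
      Polynomial.coeff_mul]
    refine mul_nonneg (by norm_num) (add_nonneg (by split_ifs <;> norm_num) ?_)
    exact Finset.sum_nonneg fun p _ => mul_nonneg (ih _) (ih _)

theorem oneSubSqrtPoly_eval_mem (k : ℕ) {x : ℝ} (hx : x ∈ Set.Icc (0 : ℝ) 1) :
    (oneSubSqrtPoly k).eval x ≤ 1 - √(1 - x) ∧
      1 - √(1 - x) ≤ (oneSubSqrtPoly k).eval x + 2 / (k + 2) := by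
  set h := 1 - √(1 - x) with hh
  have hs0 : 0 ≤ √(1 - x) := Real.sqrt_nonneg _
  have hs1 : √(1 - x) ≤ 1 := Real.sqrt_le_one.2 (by linarith [hx.1])
  have hs2 : √(1 - x) ^ 2 = 1 - x := Real.sq_sqrt (by linarith [hx.2])
  have hfix : h = (x + h ^ 2) / 2 := by rw [hh]; nlinarith
  have hh0 : 0 ≤ h := by linarith
  have hh1 : h ≤ 1 := by linarith
  have hp : 0 ≤ (oneSubSqrtPoly k).eval x := by
    rw [Polynomial.eval_eq_sum_range]
    exact Finset.sum_nonneg fun j _ => mul_nonneg (oneSubSqrtPoly_coeff_nonneg k j)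
      (pow_nonneg hx.1 j)
  induction k with
  | zero => simp [oneSubSqrtPoly]; constructor <;> linarith
  | succ k ih =>
    have hp' : 0 ≤ (oneSubSqrtPoly k).eval x := by
      rw [Polynomial.eval_eq_sum_range]
      exact Finset.sum_nonneg fun j _ => mul_nonneg (oneSubSqrtPoly_coeff_nonneg k j)
        (pow_nonneg hx.1 j)
    obtain ⟨h1, h2⟩ := ih hp'
    have e : (oneSubSqrtPoly (k + 1)).eval x =
        (x + (oneSubSqrtPoly k).eval x * (oneSubSqrtPoly k).eval x) / 2 := by
      rw [oneSubSqrtPoly]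
      simp
      ring
    rw [e]
    set p := (oneSubSqrtPoly k).eval x
    refine ⟨by nlinarith, ?_⟩
    push_cast
    have hk : (0 : ℝ) ≤ k := Nat.cast_nonneg k
    -- the error `e = h - p` becomes `e * (h - e / 2) ≤ e * (1 - e / 2)`
    have e1 : h - (x + p * p) / 2 ≤ (h - p) * (1 - (h - p) / 2) := by nlinarith
    have e2 : h - p ≤ 2 / (k + 2) := by linarith
    have e3 : (2 : ℝ) / (k + 2) ≤ 1 := by rw [div_le_one (by positivity)]; linarith
    have e4 : (h - p) * (1 - (h - p) / 2) ≤ 2 / (k + 2) * (1 - 2 / (k + 2) / 2) := by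
      nlinarith
    have e5 : (2 : ℝ) / (k + 2) * (1 - 2 / (k + 2) / 2) ≤ 2 / (k + 1 + 2) := by
      have : (2 : ℝ) / (k + 2) * (1 - 2 / (k + 2) / 2) = 2 * (k + 1) / (k + 2) ^ 2 := by
        field_simp; ring
      rw [this, div_le_div_iff₀ (by positivity) (by positivity)]
      nlinarith
    linarith

variable {ι : Type*} [Fintype ι] {Z : Type*} [MeasurableSpace Z]

theorem card_pow_mul_prod_le_sum_pow {m : ι → ℝ} (hm : ∀ i, 0 ≤ m i) :
    (Fintype.card ι : ℝ) ^ Fintype.card ι * ∏ i, m i ≤ (∑ i, m i) ^ Fintype.card ι := by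
  rcases isEmpty_or_nonempty ι with h | h
  · simp
  have hc : 0 < Fintype.card ι := Fintype.card_pos
  have h := Real.geom_mean_le_arith_mean Finset.univ (fun _ : ι => (1 : ℝ)) m (by simp)
    (by simpa using hc) (by simpa using hm)
  simp only [Real.rpow_one, one_mul, Finset.sum_const, Finset.card_univ, nsmul_eq_mul,
    mul_one] at h
  have hP : 0 ≤ ∏ i, m i := Finset.prod_nonneg fun i _ => hm i
  have h2 := pow_le_pow_left₀ (Real.rpow_nonneg hP _) h (Fintype.card ι)
  rw [Real.rpow_inv_natCast_pow hP hc.ne', div_pow, le_div_iff₀ (by positivity)] at h2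
  linarith

theorem integral_eval_prod (W : ι → Measure Z) [∀ i, IsProbabilityMeasure (W i)]
    {b : ι → Z → ℝ} (hbm : ∀ i, Measurable (b i)) (hb : ∀ i z, b i z ∈ Set.Icc (0 : ℝ) 1)
    (p : Polynomial ℝ) :
    ∫ z, p.eval (∏ i, b i (z i)) ∂(Measure.pi W) =
      ∑ k ∈ Finset.range (p.natDegree + 1), p.coeff k * ∏ i, ∫ z, b i z ^ k ∂(W i) := by
  simp_rw [Polynomial.eval_eq_sum_range, ← Finset.prod_pow]
  rw [integral_finsetSum]
  · refine Finset.sum_congr rfl fun k _ => ?_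
    rw [integral_const_mul, integral_fintype_prod_eq_prod (f := fun i z => b i z ^ k)]
  · refine fun k _ => Integrable.const_mul (Integrable.fintype_prod (f := fun i z => b i z ^ k)
      fun i => ?_) _
    refine .of_bound ((hbm i).pow_const k).aestronglyMeasurable 1 (.of_forall fun z => ?_)
    rw [Real.norm_eq_abs, abs_of_nonneg (pow_nonneg (hb i z).1 k)]
    exact pow_le_one₀ (hb i z).1 (hb i z).2

/-- Replacing independent factors by independent draws from their average distribution, that is,
averaging over all maps `I` of the indices, increases the mean of a power series with nonnegative
coefficients in the product (by the inequality of arithmetic and geometric means for the moments)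
and hence decreases the mean of `√(1 - x)`. -/
theorem sum_integral_sqrt_le [DecidableEq ι] (W : ι → Measure Z)
    [∀ i, IsProbabilityMeasure (W i)]
    {b : ι → Z → ℝ} (hbm : ∀ i, Measurable (b i)) (hb : ∀ i z, b i z ∈ Set.Icc (0 : ℝ) 1) :
    ∑ I : ι → ι, ∫ z, √(1 - ∏ j, b (I j) (z j)) ∂(Measure.pi fun j => W (I j)) ≤
      (Fintype.card ι : ℝ) ^ Fintype.card ι *
        ∫ z, √(1 - ∏ j, b j (z j)) ∂(Measure.pi W) := by
  have hprod : ∀ (I : ι → ι) (z : ι → Z), ∏ j, b (I j) (z j) ∈ Set.Icc (0 : ℝ) 1 := fun I z =>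
    ⟨Finset.prod_nonneg fun j _ => (hb _ _).1,
      Finset.prod_le_one (fun j _ => (hb _ _).1) fun j _ => (hb _ _).2⟩
  have hprodm : ∀ I : ι → ι, Measurable fun z : ι → Z => ∏ j, b (I j) (z j) := fun I =>
    Finset.measurable_fun_prod _ fun j _ => (hbm (I j)).comp (measurable_pi_apply j)
  have hsq : ∀ I : ι → ι, Integrable (fun z : ι → Z => √(1 - ∏ j, b (I j) (z j)))
      (Measure.pi fun j => W (I j)) := fun I => by
    refine .of_bound (measurable_const.sub (hprodm I)).sqrt.aestronglyMeasurable 1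
      (.of_forall fun z => ?_)
    rw [Real.norm_eq_abs, abs_of_nonneg (Real.sqrt_nonneg _)]
    exact Real.sqrt_le_one.2 (by linarith [(hprod I z).1])
  have hpe : ∀ (k : ℕ) (I : ι → ι), Integrable
      (fun z : ι → Z => 1 - (oneSubSqrtPoly k).eval (∏ j, b (I j) (z j)))
      (Measure.pi fun j => W (I j)) := fun k I => by
    refine .of_bound (measurable_const.sub
      ((oneSubSqrtPoly k).continuous.measurable.comp (hprodm I))).aestronglyMeasurable 2
      (.of_forall fun z => ?_)
    obtain ⟨h1, h2⟩ := oneSubSqrtPoly_eval_mem k (hprod I z)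
    have h3 : √(1 - ∏ j, b (I j) (z j)) ≤ 1 := Real.sqrt_le_one.2 (by linarith [(hprod I z).1])
    have h4 := Real.sqrt_nonneg (1 - ∏ j, b (I j) (z j))
    have e3 : (2 : ℝ) / (k + 2) ≤ 1 := by
      rw [div_le_one (by positivity)]
      linarith [(Nat.cast_nonneg k : (0 : ℝ) ≤ k)]
    rw [Real.norm_eq_abs, abs_le]
    constructor <;> linarith
  set N : ℝ := (Fintype.card ι : ℝ) ^ Fintype.card ι with hN
  have hN0 : 0 ≤ N := by positivity
  have hcard : ((Fintype.card (ι → ι) : ℕ) : ℝ) = N := by simp [hN]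
  set m : ι → ℕ → ℝ := fun i k => ∫ z, b i z ^ k ∂(W i) with hm
  have hm0 : ∀ i k, 0 ≤ m i k := fun i k => integral_nonneg fun z => pow_nonneg (hb i z).1 k
  have hmom : ∀ p : Polynomial ℝ, (∀ j, 0 ≤ p.coeff j) →
      N * ∫ z, p.eval (∏ j, b j (z j)) ∂(Measure.pi W) ≤
      ∑ I : ι → ι, ∫ z, p.eval (∏ j, b (I j) (z j)) ∂(Measure.pi fun j => W (I j)) := by
    intro p hp
    have hI : ∀ I : ι → ι, _ := fun I =>
      integral_eval_prod (fun j => W (I j)) (fun j => hbm (I j)) (fun j => hb (I j)) p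
    simp_rw [hI]
    rw [Finset.sum_comm, Finset.mul_sum]
    refine Finset.sum_le_sum fun k _ => ?_
    have e : ∑ I : ι → ι, ∏ j, m (I j) k = (∑ i, m i k) ^ Fintype.card ι := by
      rw [← Fintype.prod_sum fun (_ : ι) i => m i k, Finset.prod_const, Finset.card_univ]
    rw [← Finset.mul_sum, mul_left_comm]
    refine mul_le_mul_of_nonneg_left ?_ (hp k)
    rw [e]
    exact card_pow_mul_prod_le_sum_pow fun i => hm0 i k
  have hbound : ∀ k : ℕ,
      ∑ I : ι → ι, ∫ z, √(1 - ∏ j, b (I j) (z j)) ∂(Measure.pi fun j => W (I j)) ≤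
      N * (∫ z, √(1 - ∏ j, b j (z j)) ∂(Measure.pi W)) + N * (2 / (k + 2)) := by
    intro k
    have h1 : ∀ I : ι → ι, ∫ z, √(1 - ∏ j, b (I j) (z j)) ∂(Measure.pi fun j => W (I j)) ≤
        1 - ∫ z, (oneSubSqrtPoly k).eval (∏ j, b (I j) (z j)) ∂(Measure.pi fun j => W (I j)) := by
      intro I
      have hI : Integrable (fun z : ι → Z => (oneSubSqrtPoly k).eval (∏ j, b (I j) (z j)))
          (Measure.pi fun j => W (I j)) := by
        have := (integrable_const (1 : ℝ)).sub (hpe k I)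
        refine this.congr (.of_forall fun z => ?_)
        simp
      have := integral_mono (hsq I) (hpe k I) fun z => by
        have := (oneSubSqrtPoly_eval_mem k (hprod I z)).1
        dsimp only
        linarith
      rwa [integral_sub (integrable_const _) hI, integral_const, probReal_univ, one_smul] at this
    have h2 : 1 - ∫ z, (oneSubSqrtPoly k).eval (∏ j, b j (z j)) ∂(Measure.pi W) ≤
        ∫ z, √(1 - ∏ j, b j (z j)) ∂(Measure.pi W) + 2 / (k + 2) := by
      have hI : Integrable (fun z : ι → Z => (oneSubSqrtPoly k).eval (∏ j, b j (z j)))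
          (Measure.pi W) := by
        have := (integrable_const (1 : ℝ)).sub (hpe k id)
        refine this.congr (.of_forall fun z => ?_)
        simp
      have := integral_mono (hpe k id) ((hsq id).add (integrable_const (2 / ((k : ℝ) + 2))))
        fun z => by
          have := (oneSubSqrtPoly_eval_mem k (hprod id z)).2
          dsimp only [Pi.add_apply]
          linarith
      simp only [id] at this
      rw [integral_sub (integrable_const _) hI, integral_const, probReal_univ, one_smul] at this
      refine this.trans (le_of_eq ?_)
      have e := integral_add (hsq id) (integrable_const (2 / ((k : ℝ) + 2)))
      simpa using e
    calc _ ≤ ∑ I : ι → ι, (1 - ∫ z, (oneSubSqrtPoly k).eval (∏ j, b (I j) (z j))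
            ∂(Measure.pi fun j => W (I j))) := Finset.sum_le_sum fun I _ => h1 I
      _ = N - ∑ I : ι → ι, ∫ z, (oneSubSqrtPoly k).eval (∏ j, b (I j) (z j))
            ∂(Measure.pi fun j => W (I j)) := by
          rw [Finset.sum_sub_distrib, Finset.sum_const, nsmul_eq_mul, Finset.card_univ, hcard,
            mul_one]
      _ ≤ N - N * ∫ z, (oneSubSqrtPoly k).eval (∏ j, b j (z j)) ∂(Measure.pi W) :=
          sub_le_sub_left (hmom _ (oneSubSqrtPoly_coeff_nonneg k)) N
      _ = N * (1 - ∫ z, (oneSubSqrtPoly k).eval (∏ j, b j (z j)) ∂(Measure.pi W)) := by ring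
      _ ≤ N * (∫ z, √(1 - ∏ j, b j (z j)) ∂(Measure.pi W) + 2 / (k + 2)) := by gcongr
      _ = _ := by ring
  have hlim : Filter.Tendsto (fun k : ℕ => N * (∫ z, √(1 - ∏ j, b j (z j)) ∂(Measure.pi W)) +
      N * (2 / ((k : ℝ) + 2))) Filter.atTop
      (nhds (N * (∫ z, √(1 - ∏ j, b j (z j)) ∂(Measure.pi W)) + N * 0)) := by
    refine tendsto_const_nhds.add (tendsto_const_nhds.mul ?_)
    exact tendsto_const_nhds.div_atTop
      (Filter.tendsto_atTop_add_const_right _ _ tendsto_natCast_atTop_atTop)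
  have := ge_of_tendsto' hlim hbound
  simpa using this

end Mixing

/-! ### Comparison of the products with the powers of the averages -/

section Comparison

variable {Ω : Type*} [MeasurableSpace Ω]

theorem isProbabilityMeasure_avgMeasure {n : ℕ} (hn : 1 ≤ n) (P : Fin n → Measure Ω)
    [∀ i, IsProbabilityMeasure (P i)] : IsProbabilityMeasure (avgMeasure P) := ⟨by
  have : (n : ℝ≥0∞) ≠ 0 := by simp; omega
  simp [avgMeasure, ENNReal.inv_mul_cancel this]⟩

/-- A product of averages is the average of the products over all choices of the factors. -/
theorem pi_avgMeasure {n : ℕ} (hn : 1 ≤ n) (P : Fin n → Measure Ω)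
    [∀ i, IsProbabilityMeasure (P i)] :
    (Measure.pi fun _ : Fin n => avgMeasure P) =
      ((n : ℝ≥0∞)⁻¹ ^ n) • ∑ I : Fin n → Fin n, Measure.pi fun j => P (I j) := by
  have := isProbabilityMeasure_avgMeasure hn P
  refine Measure.pi_eq fun s hs => ?_
  simp only [avgMeasure, Measure.smul_apply, Measure.finsetSum_apply, Measure.pi_pi, smul_eq_mul]
  rw [Finset.prod_mul_distrib, Finset.prod_const, Finset.card_univ, Fintype.card_fin,
    Fintype.prod_sum]

/-- Splitting a power of an average into the products that it mixes: a mixture of pairs of measures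
is at most as far apart as the pairs are on average. -/
theorem tvDist_pi_avgMeasure_le {n : ℕ} (hn : 1 ≤ n) (P Q : Fin n → Measure Ω)
    [∀ i, IsProbabilityMeasure (P i)] [∀ i, IsProbabilityMeasure (Q i)] :
    (n : ℝ) ^ n * tvDist (Measure.pi fun _ : Fin n => avgMeasure P)
        (Measure.pi fun _ : Fin n => avgMeasure Q) ≤
      ∑ I : Fin n → Fin n, tvDist (Measure.pi fun j => P (I j)) (Measure.pi fun j => Q (I j)) := by
  have hn0 : (0 : ℝ) < (n : ℝ) ^ n := by positivity
  have hreal : ∀ (P : Fin n → Measure Ω) [∀ i, IsProbabilityMeasure (P i)] (E : Set (Fin n → Ω)),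
      (Measure.pi fun _ : Fin n => avgMeasure P).real E =
        ((n : ℝ) ^ n)⁻¹ * ∑ I : Fin n → Fin n, (Measure.pi fun j => P (I j)).real E := by
    intro P _ E
    rw [pi_avgMeasure hn P, measureReal_def, Measure.smul_apply, Measure.finsetSum_apply,
      smul_eq_mul, ENNReal.toReal_mul, ENNReal.toReal_sum fun I _ => measure_ne_top _ _]
    simp [measureReal_def]
  rw [← le_inv_mul_iff₀ hn0]
  refine tvDist_le fun E hE => ?_
  rw [hreal P, hreal Q, ← mul_sub, ← Finset.sum_sub_distrib, abs_mul,
    abs_of_nonneg (inv_nonneg.2 hn0.le)]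
  gcongr
  exact (Finset.abs_sum_le_sum_abs _ _).trans
    (Finset.sum_le_sum fun I _ => abs_sub_le_tvDist _ _ hE)

variable {ι : Type*} [Fintype ι] (P Q : ι → Measure Ω) [∀ i, IsProbabilityMeasure (P i)]
  [∀ i, IsProbabilityMeasure (Q i)]

/-- Observing a pair from `P i ⊗ Q i` or `Q i ⊗ P i` gives at least the information of its first
component. -/
theorem tvDist_pi_le_tvDist_pi_prod : tvDist (Measure.pi P) (Measure.pi Q) ≤
    tvDist (Measure.pi fun i => (P i).prod (Q i)) (Measure.pi fun i => (Q i).prod (P i)) := by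
  have h : ∀ (P Q : ι → Measure Ω) [∀ i, IsProbabilityMeasure (P i)]
      [∀ i, IsProbabilityMeasure (Q i)],
      MeasurePreserving (fun (z : ι → Ω × Ω) i => (z i).1)
        (Measure.pi fun i => (P i).prod (Q i)) (Measure.pi P) := fun P Q _ _ =>
    measurePreserving_pi (fun i => (P i).prod (Q i)) P fun i => measurePreserving_fst
  rw [← (h P Q).map_eq, ← (h Q P).map_eq]
  exact tvDist_map_le _ _ (h P Q).measurable

theorem abs_measureReal_prod_sub_le {X Y : Type*} [MeasurableSpace X] [MeasurableSpace Y]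
    (μ μ' : Measure X) (ν : Measure Y) [IsProbabilityMeasure μ] [IsProbabilityMeasure μ']
    [IsProbabilityMeasure ν] {E : Set (X × Y)} (hE : MeasurableSet E) :
    |(μ.prod ν).real E - (μ'.prod ν).real E| ≤ tvDist μ μ' := by
  have h : ∀ (μ : Measure X) [IsProbabilityMeasure μ],
      Integrable (fun y => μ.real ((fun x => (x, y)) ⁻¹' E)) ν ∧
      (μ.prod ν).real E = ∫ y, μ.real ((fun x => (x, y)) ⁻¹' E) ∂ν := by
    intro μ _
    have hm := measurable_measure_prodMk_right (μ := μ) hE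
    refine ⟨.of_bound hm.ennreal_toReal.aestronglyMeasurable 1 (.of_forall fun y => ?_), ?_⟩
    · rw [Real.norm_eq_abs, abs_of_nonneg measureReal_nonneg]
      exact measureReal_le_one
    · rw [measureReal_def, Measure.prod_apply_symm hE]
      exact (integral_toReal hm.aemeasurable (.of_forall fun y => measure_lt_top _ _)).symm
  rw [(h μ).2, (h μ').2, ← integral_sub (h μ).1 (h μ').1]
  refine abs_integral_le_integral_abs.trans ?_
  have := integral_mono (((h μ).1.sub (h μ').1).abs) (integrable_const (tvDist μ μ'))
    fun y => abs_sub_le_tvDist μ μ' (measurable_prodMk_right hE)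
  simpa using this

/-- Symmetrization at most doubles the distance: pass from `P ⊗ Q` to `Q ⊗ P` through `Q ⊗ Q`. -/
theorem tvDist_pi_prod_le :
    tvDist (Measure.pi fun i => (P i).prod (Q i)) (Measure.pi fun i => (Q i).prod (P i)) ≤
      2 * tvDist (Measure.pi P) (Measure.pi Q) := by
  rw [← (measurePreserving_arrowProdEquivProdArrow Ω Ω ι P Q).symm.map_eq,
    ← (measurePreserving_arrowProdEquivProdArrow Ω Ω ι Q P).symm.map_eq]
  refine (tvDist_map_le _ _ (MeasurableEquiv.measurable _)).trans (tvDist_le fun E hE => ?_)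
  have h1 := abs_measureReal_prod_sub_le (Measure.pi P) (Measure.pi Q) (Measure.pi Q) hE
  have h2 := abs_measureReal_prod_sub_le (Measure.pi P) (Measure.pi Q) (Measure.pi Q)
    (hE.preimage measurable_swap)
  have hswap : ∀ (μ ν : Measure (ι → Ω)) [SigmaFinite μ] [SigmaFinite ν],
      (μ.prod ν).real (Prod.swap ⁻¹' E) = (ν.prod μ).real E := fun μ ν _ _ => by
    rw [← Measure.prod_swap (μ := μ) (ν := ν), map_measureReal_apply measurable_swap hE]
  rw [hswap, hswap] at h2
  rw [abs_le] at h1 h2 ⊢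
  constructor <;> linarith

/-- The constant is `0.149 = 0.298 / 2`: the loss in `le_signTV`, and the factor `2` of the
symmetrization. The mixing step loses nothing. -/
theorem mul_tvDist_pi_avgMeasure_le {n : ℕ} (hn : 1 ≤ n) (P Q : Fin n → Measure Ω)
    [∀ i, IsProbabilityMeasure (P i)] [∀ i, IsProbabilityMeasure (Q i)] :
    0.149 * tvDist (Measure.pi fun _ : Fin n => avgMeasure P)
        (Measure.pi fun _ : Fin n => avgMeasure Q) ≤
      tvDist (Measure.pi P) (Measure.pi Q) := by
  choose W r hW hτ hrm hr1 hodd hA hB using fun i =>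
    exists_odd_density ((P i).prod (Q i)) ((Q i).prod (P i)) measurable_swap
      Prod.swap_swap Measure.prod_swap
  set G : (Fin n → Fin n) → ℝ := fun I =>
    ∫ z, √(1 - ∏ j, (1 - r (I j) (z j) ^ 2)) ∂(Measure.pi fun j => W (I j)) with hG
  have hTV : ∀ I : Fin n → Fin n,
      tvDist (Measure.pi fun j => (P (I j)).prod (Q (I j)))
        (Measure.pi fun j => (Q (I j)).prod (P (I j))) =
      ∫ z, signTV (fun j => r (I j) (z j)) ∂(Measure.pi fun j => W (I j)) := fun I =>
    tvDist_pi_eq_integral_signTV (fun j => W (I j)) (fun j => hτ (I j)) (fun j => hrm (I j))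
      (fun j => hr1 (I j)) (fun j => hodd (I j)) (fun j => hA (I j)) (fun j => hB (I j))
  have hmem : ∀ i z, 1 - r i z ^ 2 ∈ Set.Icc (0 : ℝ) 1 := fun i z =>
    ⟨sub_nonneg.2 ((sq_le_one_iff_abs_le_one _).2 (hr1 i z)),
      sub_le_self _ (sq_nonneg _)⟩
  have hGm : ∀ I : Fin n → Fin n, Measurable fun z : Fin n → Ω × Ω =>
      √(1 - ∏ j, (1 - r (I j) (z j) ^ 2)) := fun I => by
    have := fun j => (hrm (I j)).comp (measurable_pi_apply (X := fun _ : Fin n => Ω × Ω) j)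
    simp only [Function.comp_def] at this
    fun_prop
  have hGi : ∀ I : Fin n → Fin n, Integrable (fun z : Fin n → Ω × Ω =>
      √(1 - ∏ j, (1 - r (I j) (z j) ^ 2))) (Measure.pi fun j => W (I j)) := fun I => by
    refine .of_bound (hGm I).aestronglyMeasurable 1 (.of_forall fun z => ?_)
    rw [Real.norm_eq_abs, abs_of_nonneg (Real.sqrt_nonneg _)]
    exact Real.sqrt_le_one.2 (sub_le_self _ (Finset.prod_nonneg fun j _ => (hmem _ _).1))
  have hSi : ∀ I : Fin n → Fin n, Integrable (fun z : Fin n → Ω × Ω =>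
      signTV (fun j => r (I j) (z j))) (Measure.pi fun j => W (I j)) := fun I => by
    refine (hGi I).mono' ?_ (.of_forall fun z => ?_)
    · have h1 : ∀ ε, Measurable fun z : Fin n → Ω × Ω =>
          signLik (fun j => r (I j) (z j)) ε :=
        measurable_signLik (a := fun (z : Fin n → Ω × Ω) j => r (I j) (z j))
          fun j => (hrm (I j)).comp (measurable_pi_apply j)
      have h2 : ∀ ε, Measurable fun z : Fin n → Ω × Ω =>
          signLik (-fun j => r (I j) (z j)) ε :=
        measurable_signLik (a := fun (z : Fin n → Ω × Ω) => -fun j => r (I j) (z j))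
          fun j => ((hrm (I j)).comp (measurable_pi_apply j)).neg
      exact (measurable_const.mul (Finset.measurable_fun_sum _ fun ε _ =>
        ((h1 ε).sub (h2 ε)).abs.div_const 2)).aestronglyMeasurable
    · rw [Real.norm_eq_abs, abs_of_nonneg]
      · exact signTV_le fun j => hr1 _ _
      · exact (mul_nonneg (by norm_num) (Real.sqrt_nonneg _)).trans (le_signTV fun j => hr1 _ _)
  have hupper : ∀ I : Fin n → Fin n,
      tvDist (Measure.pi fun j => P (I j)) (Measure.pi fun j => Q (I j)) ≤ G I := fun I => by
    refine (tvDist_pi_le_tvDist_pi_prod _ _).trans ?_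
    rw [hTV I]
    exact integral_mono (hSi I) (hGi I) fun z => signTV_le fun j => hr1 _ _
  have hlower : 0.298 * G id ≤ 2 * tvDist (Measure.pi P) (Measure.pi Q) := by
    refine le_trans ?_ (tvDist_pi_prod_le P Q)
    have := hTV id
    simp only [id] at this
    rw [this, hG]
    dsimp only
    rw [← integral_const_mul]
    exact integral_mono ((hGi id).const_mul _) (hSi id) fun z => le_signTV fun j => hr1 _ _
  have hmix : ∑ I, G I ≤ (n : ℝ) ^ n * G id := by
    have := sum_integral_sqrt_le W (b := fun i z => 1 - r i z ^ 2)
      (fun i => measurable_const.sub ((hrm i).pow_const 2)) hmem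
    rwa [Fintype.card_fin] at this
  have hn0 : (0 : ℝ) < (n : ℝ) ^ n := by positivity
  have h := (tvDist_pi_avgMeasure_le hn P Q).trans
    ((Finset.sum_le_sum fun I _ => hupper I).trans hmix)
  have := le_of_mul_le_mul_left h hn0
  linarith

end Comparison

/-! ### Sufficiency of the counts -/

section Counts

variable {Ω : Type*} [Fintype Ω]

open scoped Classical in
/-- The vector of the numbers of occurrences of the letters in a word of length `n`. -/
noncomputable def letterCounts (n : ℕ) (x : Fin n → Ω) (ω : Ω) : ℕ :=
  Fintype.card {j // x j = ω}

theorem prod_eq_prod_pow_letterCounts {R : Type*} [CommMonoid R] {n : ℕ} (x : Fin n → Ω)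
    (f : Ω → R) : ∏ j, f (x j) = ∏ ω, f ω ^ letterCounts n x ω := by
  classical
  rw [← Fintype.prod_fiberwise x]
  refine Finset.prod_congr rfl fun ω _ => ?_
  rw [Finset.prod_congr rfl fun (j : {j // x j = ω}) _ => by rw [j.2], Finset.prod_const,
    Finset.card_univ]
  rfl

/-- The multinomial theorem, with the terms of `(∑ ω, p ω) ^ n` sorted by the monomial in `p`
from which they arise. -/
theorem sum_prod_letterCounts_eq {R : Type*} [CommSemiring R] [DecidableEq Ω] (n : ℕ)
    (p : Ω → R) (k : Ω → ℕ) :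
    (∑ x : Fin n → Ω, if letterCounts n x = k then ∏ j, p (x j) else 0) =
      ∑ l ∈ Finset.piAntidiag Finset.univ n,
        if l = k then (Nat.multinomial Finset.univ l : R) * ∏ ω, p ω ^ l ω else 0 := by
  have hmon : ∀ l : Ω → ℕ, ∏ ω, (MvPolynomial.C (p ω) * MvPolynomial.X ω) ^ l ω =
      MvPolynomial.monomial (Finsupp.equivFunOnFinite.symm l) (∏ ω, p ω ^ l ω) := fun l => by
    rw [MvPolynomial.monomial_eq, Finsupp.prod_fintype _ _ fun ω => pow_zero _, map_prod,
      ← Finset.prod_mul_distrib]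
    exact Finset.prod_congr rfl fun ω _ => by simp [mul_pow]
  have hexp := Finset.sum_pow_eq_sum_piAntidiag (Finset.univ : Finset Ω)
    (fun ω => MvPolynomial.C (p ω) * MvPolynomial.X ω) n
  have hpow : (∑ ω, MvPolynomial.C (p ω) * MvPolynomial.X ω) ^ n =
      ∑ x : Fin n → Ω, ∏ j, (MvPolynomial.C (p (x j)) * MvPolynomial.X (x j)) := by
    rw [← Fintype.prod_sum fun (_ : Fin n) ω => MvPolynomial.C (p ω) * MvPolynomial.X ω]
    simp
  rw [hpow] at hexp
  have hcoeff := congrArg (MvPolynomial.coeff (Finsupp.equivFunOnFinite.symm k)) hexp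
  rw [MvPolynomial.coeff_sum, MvPolynomial.coeff_sum] at hcoeff
  convert hcoeff using 2 with x _ l _
  · rw [prod_eq_prod_pow_letterCounts x fun ω => MvPolynomial.C (p ω) * MvPolynomial.X ω, hmon,
      MvPolynomial.coeff_monomial, ← prod_eq_prod_pow_letterCounts x p]
    simp only [EmbeddingLike.apply_eq_iff_eq]
  · rw [hmon, ← map_natCast MvPolynomial.C, MvPolynomial.coeff_C_mul,
      MvPolynomial.coeff_monomial, mul_ite, mul_zero]
    simp only [EmbeddingLike.apply_eq_iff_eq]

variable [MeasurableSpace Ω] [MeasurableSingletonClass Ω]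

theorem map_letterCounts_pi (n : ℕ) (P : Measure Ω) [IsProbabilityMeasure P] :
    (Measure.pi fun _ : Fin n => P).map (letterCounts n) = multinomialMeasure n P := by
  classical
  refine Measure.ext_of_singleton fun k => ?_
  rw [Measure.map_apply (measurable_of_countable _) (measurableSet_singleton k)]
  have h1 : (Measure.pi fun _ : Fin n => P) (letterCounts n ⁻¹' {k}) =
      ∑ x : Fin n → Ω, if letterCounts n x = k then ∏ j, P {x j} else 0 := by
    have : letterCounts n ⁻¹' {k} =
        ((Finset.univ.filter fun x : Fin n → Ω => letterCounts n x = k : Finset (Fin n → Ω)) :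
          Set (Fin n → Ω)) := by
      ext x; simp
    rw [this, ← sum_measure_singleton, Finset.sum_filter]
    simp
  rw [h1, sum_prod_letterCounts_eq n (fun ω => P {ω}) k, multinomialMeasure,
    Measure.finsetSum_apply]
  refine Finset.sum_congr (by congr!) fun l _ => ?_
  rw [Measure.smul_apply, Measure.dirac_apply' _ (measurableSet_singleton k), smul_eq_mul,
    Set.indicator_apply]
  simp

/-- The likelihood ratio of two powers depends on a word only through its letter counts, so the
optimal event is a preimage under `letterCounts`. -/
theorem tvDist_pi_eq_tvDist_multinomialMeasure (n : ℕ) (P Q : Measure Ω)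
    [IsProbabilityMeasure P] [IsProbabilityMeasure Q] :
    tvDist (Measure.pi fun _ : Fin n => P) (Measure.pi fun _ : Fin n => Q) =
      tvDist (multinomialMeasure n P) (multinomialMeasure n Q) := by
  classical
  rw [← map_letterCounts_pi, ← map_letterCounts_pi]
  have hmc : Measurable (letterCounts n : (Fin n → Ω) → Ω → ℕ) := measurable_of_countable _
  refine le_antisymm ?_ (tvDist_map_le _ _ hmc)
  have := Measure.isProbabilityMeasure_map (μ := Measure.pi fun _ : Fin n => P) hmc.aemeasurable
  have := Measure.isProbabilityMeasure_map (μ := Measure.pi fun _ : Fin n => Q) hmc.aemeasurable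
  have hlik : ∀ (P : Measure Ω) [IsProbabilityMeasure P] (x : Fin n → Ω),
      (Measure.pi fun _ : Fin n => P).real {x} = ∏ ω, P.real {ω} ^ letterCounts n x ω := by
    intro P _ x
    rw [← prod_eq_prod_pow_letterCounts x fun ω => P.real {ω}, measureReal_def,
      Measure.pi_singleton, ENNReal.toReal_prod]
    rfl
  have hreal : ∀ (P : Measure Ω) [IsProbabilityMeasure P] (E : Set (Fin n → Ω)),
      (Measure.pi fun _ : Fin n => P).real E =
        ∑ x, if x ∈ E then ∏ ω, P.real {ω} ^ letterCounts n x ω else 0 := by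
    intro P _ E
    rw [← Finset.sum_filter]
    simp_rw [← hlik]
    rw [sum_measureReal_singleton]
    simp
  set E' : Set (Ω → ℕ) := {k | ∏ ω, Q.real {ω} ^ k ω ≤ ∏ ω, P.real {ω} ^ k ω}
  have hopt := (le_abs_self _).trans (abs_sub_le_tvDist
    ((Measure.pi fun _ : Fin n => P).map (letterCounts n))
    ((Measure.pi fun _ : Fin n => Q).map (letterCounts n)) (E := E') (.of_discrete))
  rw [map_measureReal_apply hmc .of_discrete, map_measureReal_apply hmc .of_discrete] at hopt
  have hle : ∀ E : Set (Fin n → Ω),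
      (Measure.pi fun _ : Fin n => P).real E - (Measure.pi fun _ : Fin n => Q).real E ≤
      tvDist ((Measure.pi fun _ : Fin n => P).map (letterCounts n))
        ((Measure.pi fun _ : Fin n => Q).map (letterCounts n)) := by
    intro E
    refine le_trans ?_ hopt
    rw [hreal P, hreal Q, hreal P, hreal Q, ← Finset.sum_sub_distrib, ← Finset.sum_sub_distrib]
    refine Finset.sum_le_sum fun x _ => ?_
    by_cases hx : letterCounts n x ∈ E'
    · have hx' : x ∈ letterCounts n ⁻¹' E' := hx
      have : ∏ ω, Q.real {ω} ^ letterCounts n x ω ≤ ∏ ω, P.real {ω} ^ letterCounts n x ω := hx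
      rw [if_pos hx', if_pos hx']
      split_ifs <;> linarith
    · have hx' : x ∉ letterCounts n ⁻¹' E' := hx
      have : ∏ ω, P.real {ω} ^ letterCounts n x ω < ∏ ω, Q.real {ω} ^ letterCounts n x ω :=
        not_le.1 hx
      rw [if_neg hx', if_neg hx']
      split_ifs <;> linarith
  refine tvDist_le fun E hE => abs_le.2 ⟨?_, hle E⟩
  have h := hle Eᶜ
  rw [probReal_compl_eq_one_sub hE, probReal_compl_eq_one_sub hE] at h
  linarith

end Counts

theorem theorem4 :
    (∃ c : ℝ, 0.1489 < c ∧
      ∀ (n : ℕ) (_ : 1 ≤ n) (Ω : Type*) [MeasurableSpace Ω] (P Q : Fin n → Measure Ω)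
        [∀ i, IsProbabilityMeasure (P i)] [∀ i, IsProbabilityMeasure (Q i)],
        tvDist (Measure.pi P) (Measure.pi Q) ≥
          c * tvDist (Measure.pi fun _ : Fin n => avgMeasure P)
            (Measure.pi fun _ : Fin n => avgMeasure Q)) ∧
    (∀ (n : ℕ) (_ : 1 ≤ n) (Ω : Type*) [Fintype Ω] [MeasurableSpace Ω]
        [MeasurableSingletonClass Ω] (P Q : Fin n → Measure Ω)
        [∀ i, IsProbabilityMeasure (P i)] [∀ i, IsProbabilityMeasure (Q i)],
        tvDist (Measure.pi fun _ : Fin n => avgMeasure P)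
            (Measure.pi fun _ : Fin n => avgMeasure Q) =
          tvDist (multinomialMeasure n (avgMeasure P)) (multinomialMeasure n (avgMeasure Q))) := by
  refine ⟨⟨0.149, by norm_num, fun n hn Ω _ P Q _ _ => mul_tvDist_pi_avgMeasure_le hn P Q⟩,
    fun n hn Ω _ _ _ P Q _ _ => ?_⟩
  have := isProbabilityMeasure_avgMeasure hn P
  have := isProbabilityMeasure_avgMeasure hn Q
  exact tvDist_pi_eq_tvDist_multinomialMeasure n (avgMeasure P) (avgMeasure Q)
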